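/- \textbf{Theorem.} For a set $S$ of positive integers, let $G(S)$ be the graph with vertex set $\mathbb{Z}$ in which $i$ and $j$ are adjacent if and only if $|i-j|\in S$. The density of a set $A\subseteq\mathbb{Z}$ is $\delta(A)=\limsup_{N\to\infty}\frac{|A\cap[-N,N]|}{2N+1}$, and the independence ratio $\overline{\alpha}(S)$ is the supremum of $\delta(A)$ over all independent sets $A$ of $G(S)$. Then for every integer $k\ge 3$, \[ \overline{\alpha}(\{1,k,k+3\})=\begin{cases} \dfrac{2k+5}{5k+20} & \text{if } k\equiv 0 \pmod 5,\\[1ex] \dfrac{2}{5} & \text{if } k\equiv 1 \pmod 5,\\[1ex] \dfrac{2k+6}{5k+20} & \text{if } k\equiv 2 \pmod 5,\\[1ex] \dfrac{4k+3}{10k+15} & \text{if } k\equiv 3 \pmod 5,\\[1ex] \dfrac{2k+7}{5k+20} & \text{if } k\equiv 4 \pmod 5. \end{cases} \] -/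

import Mathlib

open Filter

/-- The distance graph `G(S)`: its vertex set is `ℤ`, and two distinct integers `i`, `j` are
adjacent if and only if `|i - j| ∈ S`. (For sets `S` of positive integers the condition `i ≠ j`
is automatic.) -/
def distanceGraph (S : Set ℕ) : SimpleGraph ℤ where
  Adj i j := i ≠ j ∧ (i - j).natAbs ∈ S
  symm := ⟨by
    rintro i j ⟨hne, h⟩
    exact ⟨hne.symm, by rwa [← Int.natAbs_neg, neg_sub]⟩⟩
  loopless := ⟨by
    rintro i ⟨hne, _⟩
    exact hne rfl⟩

/-- The (upper) density `δ(A) = limsup_{N → ∞} |A ∩ [-N, N]| / (2N + 1)` of a set of integers.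
The sequence takes values in `[0, 1]`, so this is the usual limsup of a bounded sequence. -/
noncomputable def upperDensity (A : Set ℤ) : ℝ :=
  limsup (fun N : ℕ => ((A ∩ Set.Icc (-(N : ℤ)) (N : ℤ)).ncard : ℝ) / (2 * (N : ℝ) + 1)) atTop

/-- The independence ratio of `G(S)`: the supremum of `δ(A)` over all independent sets `A` of
`G(S)`. The set of values is nonempty (`∅` is independent) and bounded above by `1`. -/
noncomputable def independenceRatio (S : Set ℕ) : ℝ :=
  sSup {d : ℝ | ∃ A : Set ℤ, (distanceGraph S).IsIndepSet A ∧ upperDensity A = d}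

/-!
Write `χ` for the indicator function of an independent set of `G({1, k, k + 3})`. The graph contains
many `5`-cycles, such as `y, y + 1, y + 2, y + 3, y + 3 + k`, and an independent set meets each of
them in at most two points. This gives the bound `2 / 5`; the corrections come from integrality.

Suppose `k % 5 ≠ 3`, put `L = k + 4`, and let `f x` be the number of elements in `[x, x + L)`.
A cyclic family of `5`-cycles gives `4 * f x + f (x + k) ≤ 2 * L`
(`four_mul_window_add_window_le`). Let `q = ⌊2 * L / 5⌋`, so that `2 * L ≤ 5 * q + 3`, the remainder
`4` occurring only for `k % 5 = 3`. If `f x = q + u` with `u ≥ 1`, then `f (x + k) ≤ q + 3 - 4 * u`,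
hence `f (x + k) ≤ q - u`: every excess is compensated at the window translated by `k`, and the
average of `f` is at most `q` (`upperDensity_le_of_mod_ne`). So the density is at most `q / L`.

Suppose `k = 5 * r + 3`. Then every window of length `n = 2 * k + 3 = 10 * r + 9` has at most
`4 * r + 3` elements (`window_le`). Modulo `n` the steps `k` and `k + 3` are opposite, and every edge
of the circulant graph on `ℤ / n` with steps `1` and `k` comes from an edge inside the window, with
one exception: the end points of the window are not adjacent. If they do not both belong to the set,
averaging over the `5`-cycles of the circulant graph suffices. If they do, doubling turns the steps
into `2` and `3`, any five consecutive residues form a `5`-cycle, and the four residues starting at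
an end point contain one element only; the rest splits into `2 * r + 1` blocks of five.

Both bounds are attained by periodic sets, `gapSet` and `doubledGapSet`.
-/

/-! ### Counting in windows -/

/-- The shift of a window sum by one step, in terms of its end points. -/
lemma sum_range_shift (b : ℕ → ℤ) (n : ℕ) :
    ∑ i ∈ Finset.range n, b (i + 1) = ∑ i ∈ Finset.range n, b i + b n - b 0 := by
  have h₁ := Finset.sum_range_succ b n
  have h₂ := Finset.sum_range_succ' b n
  linarith

lemma sum_range_five_mul (b : ℕ → ℤ) (r : ℕ) :
    ∑ y ∈ Finset.range (5 * r), b y = ∑ i ∈ Finset.range r,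
      (b (5 * i) + b (5 * i + 1) + b (5 * i + 2) + b (5 * i + 3) + b (5 * i + 4)) := by
  induction r with
  | zero => simp
  | succ r ih =>
    rw [Finset.sum_range_succ _ r, ← ih, show 5 * (r + 1) = 5 * r + 4 + 1 by ring]
    simp only [Finset.sum_range_succ]
    ring

lemma five_cycle_le {p q r s t : ℤ} (h₁ : p + q ≤ 1) (h₂ : q + r ≤ 1) (h₃ : r + s ≤ 1)
    (h₄ : s + t ≤ 1) (h₅ : t + p ≤ 1) : p + q + r + s + t ≤ 2 := by
  omega

section Windows

variable {k : ℕ} {b : ℕ → ℤ}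

/-- Independence forces the window of length `k + 4` to behave cyclically, together with its
translate by `k`: each residue `y` modulo `k + 4` gives a `5`-cycle made of the cyclic interval
`y, …, y + 3` in the first window and of the position of `y + 3` in the second one. For the three
intervals that wrap around, the needed edges are genuine edges of the graph because the windows
overlap in four positions. -/
lemma four_mul_window_add_window_le (h1 : ∀ i, b i + b (i + 1) ≤ 1)
    (hk : ∀ i, b i + b (i + k) ≤ 1) (hk3 : ∀ i, b i + b (i + k + 3) ≤ 1) :
    4 * ∑ i ∈ Finset.range (k + 4), b i + ∑ i ∈ Finset.range (k + 4), b (i + k)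
      ≤ 2 * ((k : ℤ) + 4) := by
  have key : ∑ y ∈ Finset.range (k + 1), (b y + b (y + 1) + b (y + 2) + b (y + 3) + b (y + 3 + k))
      ≤ ∑ y ∈ Finset.range (k + 1), (2 : ℤ) := by
    refine Finset.sum_le_sum fun y _ => five_cycle_le (h1 y) (h1 (y + 1)) (h1 (y + 2)) (hk _) ?_
    have := hk3 y
    rw [show y + 3 + k = y + k + 3 by ring]
    linarith
  simp only [Finset.sum_add_distrib, Finset.sum_const, Finset.card_range, nsmul_eq_mul] at key
  have s1 := sum_range_shift b (k + 1)
  have s2 := sum_range_shift (fun i => b (i + 1)) (k + 1)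
  have s3 := sum_range_shift (fun i => b (i + 2)) (k + 1)
  have e1 : ∑ i ∈ Finset.range (k + 4), b i
      = ∑ i ∈ Finset.range (k + 1), b i + b (k + 1) + b (k + 2) + b (k + 3) := by
    simp only [Finset.sum_range_succ]
  have e2 : ∑ i ∈ Finset.range (k + 4), b (i + k)
      = ∑ i ∈ Finset.range (k + 1), b (i + 3 + k) + b (2 + k) + b (1 + k) + b (0 + k) := by
    rw [show k + 4 = k + 1 + 1 + 1 + 1 by ring]
    simp only [Finset.sum_range_succ']
  have c1 : b (k + 1) + b (k + 2) + b (k + 3) + b 0 + b k ≤ 2 :=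
    five_cycle_le (h1 _) (h1 _) (by have := hk3 0; simp at this; linarith)
      (by have := hk 0; simp at this; linarith) (h1 k)
  have c2 : b (k + 2) + b (k + 3) + b 0 + b 1 + b (k + 1) ≤ 2 :=
    five_cycle_le (h1 _) (by have := hk3 0; simp at this; linarith) (h1 0)
      (by have := hk 1; rw [add_comm 1 k] at this; linarith) (h1 _)
  have c3 : b (k + 3) + b 0 + b 1 + b 2 + b (k + 2) ≤ 2 :=
    five_cycle_le (by have := hk3 0; simp at this; linarith) (h1 0) (h1 1)
      (by have := hk 2; rw [add_comm 2 k] at this; linarith) (h1 _)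
  simp only [add_assoc, Nat.reduceAdd, zero_add, add_comm 2 k, add_comm 1 k] at *
  push_cast at key
  linarith

/-- A window of length `2 * k + 3` whose two end points do not both belong to the set is
independent in the circulant graph on `ℤ / (2 * k + 3)` with steps `1` and `k`, where each vertex
is the apex of one `5`-cycle. -/
lemma five_mul_window_le (h1 : ∀ i, b i + b (i + 1) ≤ 1) (hk : ∀ i, b i + b (i + k) ≤ 1)
    (hk3 : ∀ i, b i + b (i + k + 3) ≤ 1) (hends : b (2 * k + 2) + b 0 ≤ 1) :
    5 * ∑ i ∈ Finset.range (2 * k + 3), b i ≤ 2 * (2 * (k : ℤ) + 3) := by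
  have key₁ : ∑ y ∈ Finset.range k, (b y + b (y + 1) + b (y + 2) + b (y + 3) + b (y + k + 3))
      ≤ ∑ y ∈ Finset.range k, (2 : ℤ) := by
    refine Finset.sum_le_sum fun y _ => five_cycle_le (h1 y) (h1 (y + 1)) (h1 (y + 2)) ?_ ?_
    · have := hk (y + 3)
      rwa [show y + 3 + k = y + k + 3 by ring] at this
    · have := hk3 y
      linarith
  have key₂ : ∑ y ∈ Finset.range k,
      (b (y + k) + b (y + k + 1) + b (y + k + 2) + b (y + k + 3) + b y)
      ≤ ∑ y ∈ Finset.range k, (2 : ℤ) := by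
    refine Finset.sum_le_sum fun y _ =>
      five_cycle_le (h1 _) (h1 (y + k + 1)) (h1 (y + k + 2)) ?_ (hk y)
    have := hk3 y
    linarith
  simp only [Finset.sum_add_distrib, Finset.sum_const, Finset.card_range, nsmul_eq_mul]
    at key₁ key₂
  have s1 := sum_range_shift b k
  have s2 := sum_range_shift (fun i => b (i + 1)) k
  have s3 := sum_range_shift (fun i => b (i + 2)) k
  have t1 := sum_range_shift (fun i => b (i + k)) k
  have t2 := sum_range_shift (fun i => b (i + k + 1)) k
  have t3 := sum_range_shift (fun i => b (i + k + 2)) k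
  have e : ∑ i ∈ Finset.range (2 * k + 3), b i = ∑ i ∈ Finset.range k, b i
      + ∑ i ∈ Finset.range k, b (i + k) + b (2 * k) + b (2 * k + 1) + b (2 * k + 2) := by
    rw [show 2 * k + 3 = k + k + 1 + 1 + 1 by ring]
    simp only [Finset.sum_range_succ]
    rw [Finset.sum_range_add, two_mul]
    simp only [add_comm]
  have g : b 0 + b k ≤ 1 := by simpa using hk 0
  have g1 : b 1 + b (k + 1) ≤ 1 := by simpa [add_comm] using hk 1
  have g2 : b 2 + b (k + 2) ≤ 1 := by simpa [add_comm] using hk 2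
  have g3 : b k + b (2 * k) ≤ 1 := by simpa [two_mul] using hk k
  have g4 : b (k + 1) + b (2 * k + 1) ≤ 1 := by
    have := hk (k + 1)
    rwa [show k + 1 + k = 2 * k + 1 by ring] at this
  have g5 : b (k + 2) + b (2 * k + 2) ≤ 1 := by
    have := hk (k + 2)
    rwa [show k + 2 + k = 2 * k + 2 by ring] at this
  have c1 : b (2 * k) + b (2 * k + 1) + b (2 * k + 2) + b 0 + b k ≤ 2 :=
    five_cycle_le (h1 _) (h1 _) hends g g3
  have c2 : b (2 * k + 1) + b (2 * k + 2) + b 0 + b 1 + b (k + 1) ≤ 2 :=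
    five_cycle_le (h1 _) hends (h1 0) g1 g4
  have c3 : b (2 * k + 2) + b 0 + b 1 + b 2 + b (k + 2) ≤ 2 :=
    five_cycle_le hends (h1 0) (h1 1) g2 g5
  simp only [add_assoc, Nat.reduceAdd, zero_add, add_comm 1 k, ← two_mul k] at *
  linarith

/-- A window of length `2 * k + 3` whose two end points both belong to the set. Ordering the window
as `0, k + 2, 1, k + 3, 2, k + 4, …` makes any five consecutive positions a `5`-cycle, and the
first four positions contribute only `b 0`. -/
lemma window_le_of_ends {r : ℕ} (h1 : ∀ i, b i + b (i + 1) ≤ 1) (hk : ∀ i, b i + b (i + k) ≤ 1)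
    (hk3 : ∀ i, b i + b (i + k + 3) ≤ 1) (hr : k = 5 * r + 3) (h0 : b 0 = 1)
    (hlast : b (2 * k + 2) = 1) :
    ∑ i ∈ Finset.range (2 * k + 3), b i ≤ 4 * (r : ℤ) + 3 := by
  have blocks : ∑ y ∈ Finset.range (5 * r), (b (y + 2) + b (y + k + 4)) ≤ 4 * (r : ℤ) := by
    rw [sum_range_five_mul]
    calc _ ≤ ∑ i ∈ Finset.range r, (4 : ℤ) := Finset.sum_le_sum fun i _ => by
            have c1 := five_cycle_le (h1 (5 * i + 2)) (h1 (5 * i + 3)) (hk (5 * i + 4))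
              (h1 (5 * i + 4 + k)) (by
                have := hk3 (5 * i + 2)
                rw [show 5 * i + 2 + k + 3 = 5 * i + 4 + k + 1 by ring] at this
                linarith)
            have c2 := five_cycle_le (h1 (5 * i + 5)) (hk (5 * i + 6)) (h1 (5 * i + 6 + k))
              (h1 (5 * i + 6 + k + 1)) (by
                have := hk3 (5 * i + 5)
                rw [show 5 * i + 5 + k + 3 = 5 * i + 6 + k + 1 + 1 by ring] at this
                linarith)
            simp only [add_assoc, Nat.reduceAdd, add_comm _ k] at *
            linarith
      _ = 4 * (r : ℤ) := by simp [mul_comm]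
  -- The last five positions in this order.
  have tail : b (k - 1) + b k + b (k + 1) + b (2 * k + 1) + b (2 * k + 2) ≤ 2 := by
    obtain ⟨m, hm⟩ : ∃ m, k = m + 1 := ⟨5 * r + 2, by omega⟩
    have a1 := h1 m
    have a2 := hk (k + 1)
    have a3 := hk3 m
    rw [show k + 1 + k = 2 * k + 1 by ring] at a2
    rw [show m + k + 3 = 2 * k + 2 by omega] at a3
    rw [← hm] at a1
    rw [show k - 1 = m by omega]
    exact five_cycle_le a1 (h1 _) a2 (h1 _) (by linarith)
  have z1 : b 1 ≤ 0 := by have := h1 0; simp only [zero_add] at this; linarith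
  have z2 : b (k + 2) ≤ 0 := by
    have := hk (k + 2)
    rw [show k + 2 + k = 2 * k + 2 by ring] at this
    linarith
  have z3 : b (k + 3) ≤ 0 := by have := hk3 0; simp only [zero_add] at this; linarith
  have e : ∑ i ∈ Finset.range (2 * k + 3), b i = b 0 + b 1
      + ∑ y ∈ Finset.range (5 * r), b (y + 2) + b (k - 1) + b k + b (k + 1) + b (k + 2) + b (k + 3)
      + ∑ y ∈ Finset.range (5 * r), b (y + k + 4) + b (2 * k + 1) + b (2 * k + 2) := by
    have e₁ := Finset.sum_range_add b (k + 4) (5 * r + 2)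
    have e₂ := Finset.sum_range_add b 2 (5 * r + 5)
    rw [show k + 4 + (5 * r + 2) = 2 * k + 3 by omega, Finset.sum_range_succ _ (5 * r + 1),
      Finset.sum_range_succ _ (5 * r), show k + 4 + (5 * r) = 2 * k + 1 by omega,
      show k + 4 + (5 * r + 1) = 2 * k + 2 by omega] at e₁
    rw [show 2 + (5 * r + 5) = k + 4 by omega, Finset.sum_range_succ _ (5 * r + 4),
      Finset.sum_range_succ _ (5 * r + 3), Finset.sum_range_succ _ (5 * r + 2),
      Finset.sum_range_succ _ (5 * r + 1), Finset.sum_range_succ _ (5 * r),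
      show 2 + 5 * r = k - 1 by omega, show 2 + (5 * r + 1) = k by omega,
      show 2 + (5 * r + 2) = k + 1 by omega, show 2 + (5 * r + 3) = k + 2 by omega,
      show 2 + (5 * r + 4) = k + 3 by omega] at e₂
    have e₃ : ∑ i ∈ Finset.range 2, b i = b 0 + b 1 := by simp [Finset.sum_range_succ]
    simp only [show ∀ y, k + 4 + y = y + k + 4 from fun y => by ring,
      show ∀ y, 2 + y = y + 2 from fun y => add_comm 2 y] at e₁ e₂
    linarith
  rw [Finset.sum_add_distrib] at blocks
  linarith

lemma window_le {r : ℕ} (hb : ∀ i, b i = 0 ∨ b i = 1) (h1 : ∀ i, b i + b (i + 1) ≤ 1)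
    (hk : ∀ i, b i + b (i + k) ≤ 1) (hk3 : ∀ i, b i + b (i + k + 3) ≤ 1) (hr : k = 5 * r + 3) :
    ∑ i ∈ Finset.range (2 * k + 3), b i ≤ 4 * (r : ℤ) + 3 := by
  by_cases hends : b (2 * k + 2) + b 0 ≤ 1
  · have := five_mul_window_le h1 hk hk3 hends
    subst hr
    push_cast at this
    omega
  · have h0 := hb 0
    have hl := hb (2 * k + 2)
    exact window_le_of_ends h1 hk hk3 hr (by omega) (by omega)

end Windows

/-! ### Averaging window sums -/

lemma sum_Icc_neg_succ (g : ℤ → ℤ) (N : ℕ) :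
    ∑ x ∈ Finset.Icc (-((N + 1 : ℕ) : ℤ)) ((N + 1 : ℕ) : ℤ), g x
      = ∑ x ∈ Finset.Icc (-(N : ℤ)) N, g x + g (N + 1) + g (-(N + 1)) := by
  have : Finset.Icc (-((N + 1 : ℕ) : ℤ)) ((N + 1 : ℕ) : ℤ)
      = insert ((N : ℤ) + 1) (insert (-((N : ℤ) + 1)) (Finset.Icc (-(N : ℤ)) N)) := by
    ext x
    simp only [Finset.mem_Icc, Finset.mem_insert]
    push_cast
    omega
  rw [this, Finset.sum_insert, Finset.sum_insert]
  · ring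
  · simp
  · simp only [Finset.mem_insert, Finset.mem_Icc]
    omega

lemma sum_Icc_neg_shift_one (g : ℤ → ℤ) (N : ℕ) :
    ∑ x ∈ Finset.Icc (-(N : ℤ)) N, g (x + 1)
      = ∑ x ∈ Finset.Icc (-(N : ℤ)) N, g x + g (N + 1) - g (-N) := by
  induction N with
  | zero => simp
  | succ N ih =>
    rw [sum_Icc_neg_succ, sum_Icc_neg_succ, ih]
    push_cast
    rw [show -((N : ℤ) + 1) + 1 = -N by ring]
    ring

/-- Translating a bounded function changes its sum over `[-N, N]` by an amount that does not
depend on `N`. -/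
lemma abs_sum_Icc_neg_shift_sub_le {g : ℤ → ℤ} {C : ℤ} (h0 : ∀ x, 0 ≤ g x) (hC : ∀ x, g x ≤ C)
    (s N : ℕ) :
    |∑ x ∈ Finset.Icc (-(N : ℤ)) N, g (x + s) - ∑ x ∈ Finset.Icc (-(N : ℤ)) N, g x| ≤ C * s := by
  induction s with
  | zero => simp
  | succ s ih =>
    have h := sum_Icc_neg_shift_one (fun x => g (x + s)) N
    have e : ∀ x : ℤ, x + 1 + (s : ℤ) = x + ((s + 1 : ℕ) : ℤ) := fun x => by push_cast; ring
    simp only [e] at h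
    rw [h]
    have a₁ := h0 ((N : ℤ) + ((s + 1 : ℕ) : ℤ))
    have a₂ := hC ((N : ℤ) + ((s + 1 : ℕ) : ℤ))
    have a₃ := h0 (-(N : ℤ) + s)
    have a₄ := hC (-(N : ℤ) + s)
    rw [abs_le] at ih ⊢
    push_cast at *
    constructor <;> linarith [ih.1, ih.2]

/-- Summing all windows of length `n` that start in `[-N, N]` counts each point about `n` times. -/
lemma abs_sum_window_sub_le {g : ℤ → ℤ} (h0 : ∀ x, 0 ≤ g x) (h1 : ∀ x, g x ≤ 1) (n N : ℕ) :
    |∑ x ∈ Finset.Icc (-(N : ℤ)) N, ∑ i ∈ Finset.range n, g (x + i)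
      - n * ∑ x ∈ Finset.Icc (-(N : ℤ)) N, g x| ≤ (n : ℤ) * n := by
  have e : (n : ℤ) * ∑ x ∈ Finset.Icc (-(N : ℤ)) N, g x
      = ∑ i ∈ Finset.range n, ∑ x ∈ Finset.Icc (-(N : ℤ)) N, g x := by simp
  rw [Finset.sum_comm, e, ← Finset.sum_sub_distrib]
  calc _ ≤ ∑ i ∈ Finset.range n, |∑ x ∈ Finset.Icc (-(N : ℤ)) N, g (x + i)
            - ∑ x ∈ Finset.Icc (-(N : ℤ)) N, g x| := Finset.abs_sum_le_sum_abs _ _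
    _ ≤ ∑ i ∈ Finset.range n, (n : ℤ) := Finset.sum_le_sum fun i hi => by
        have := abs_sum_Icc_neg_shift_sub_le h0 h1 i N
        have hi' := Finset.mem_range.1 hi
        linarith [(by exact_mod_cast hi'.le : (i : ℤ) ≤ n)]
    _ = (n : ℤ) * n := by simp

/-- The indicator function of a set of integers, with integer values. -/
noncomputable def chi (A : Set ℤ) : ℤ → ℤ := A.indicator 1

section Indicator

variable {A : Set ℤ} {x y : ℤ}

lemma chi_of_mem (h : x ∈ A) : chi A x = 1 := Set.indicator_of_mem h _

lemma chi_of_notMem (h : x ∉ A) : chi A x = 0 := Set.indicator_of_notMem h _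

lemma chi_eq_zero_or_one (A : Set ℤ) (x : ℤ) : chi A x = 0 ∨ chi A x = 1 := by
  by_cases h : x ∈ A
  · exact Or.inr (chi_of_mem h)
  · exact Or.inl (chi_of_notMem h)

lemma chi_nonneg (A : Set ℤ) (x : ℤ) : 0 ≤ chi A x := by
  have := chi_eq_zero_or_one A x
  omega

lemma chi_le_one (A : Set ℤ) (x : ℤ) : chi A x ≤ 1 := by
  have := chi_eq_zero_or_one A x
  omega

lemma ncard_inter_Icc_eq (A : Set ℤ) (N : ℕ) :
    ((A ∩ Set.Icc (-(N : ℤ)) N).ncard : ℤ) = ∑ x ∈ Finset.Icc (-(N : ℤ)) N, chi A x := by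
  classical
  have : A ∩ Set.Icc (-(N : ℤ)) N = ((Finset.Icc (-(N : ℤ)) N).filter (· ∈ A) : Finset ℤ) := by
    ext x
    simp only [Set.mem_inter_iff, Set.mem_Icc, Finset.coe_filter, Finset.mem_Icc,
      Set.mem_ofPred_eq]
    tauto
  rw [this, Set.ncard_coe_finset, Finset.card_filter]
  push_cast
  exact Finset.sum_congr rfl fun x _ => by simp [chi, Set.indicator_apply]

end Indicator

lemma tendsto_add_div_two_mul_add_one (c C : ℝ) :
    Tendsto (fun N : ℕ => c + C / (2 * (N : ℝ) + 1)) atTop (nhds c) := by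
  have h : Tendsto (fun N : ℕ => 2 * (N : ℝ) + 1) atTop atTop :=
    tendsto_atTop_add_const_right _ _
      (tendsto_natCast_atTop_atTop.const_mul_atTop (by norm_num))
  simpa using (h.const_div_atTop C).const_add c

lemma density_nonneg (A : Set ℤ) (N : ℕ) :
    0 ≤ ((A ∩ Set.Icc (-(N : ℤ)) (N : ℤ)).ncard : ℝ) / (2 * (N : ℝ) + 1) := by
  positivity

/-- If every window of length `n` has at most `q` elements up to a bounded coboundary `p`, then
the upper density is at most `q / n`. -/
lemma upperDensity_le_of_window {A : Set ℤ} {n s : ℕ} {q C : ℤ} {p : ℤ → ℤ} (hn : 0 < n)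
    (hp : ∀ x, 0 ≤ p x) (hpC : ∀ x, p x ≤ C)
    (h : ∀ x, ∑ i ∈ Finset.range n, chi A (x + s + i) ≤ q + (p (x + s) - p x)) :
    upperDensity A ≤ q / n := by
  have bound (N : ℕ) : (n : ℤ) * ((A ∩ Set.Icc (-(N : ℤ)) N).ncard : ℤ)
      ≤ q * (2 * N + 1) + (C * s + n * s + n * n) := by
    rw [ncard_inter_Icc_eq]
    have a₁ := abs_le.1 (abs_sum_Icc_neg_shift_sub_le hp hpC s N)
    have a₂ := abs_le.1 (abs_sum_window_sub_le (g := fun x => chi A (x + s))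
      (fun x => chi_nonneg A _) (fun x => chi_le_one A _) n N)
    have a₃ := abs_le.1 (abs_sum_Icc_neg_shift_sub_le (chi_nonneg A) (chi_le_one A) s N)
    have a₄ : ∑ x ∈ Finset.Icc (-(N : ℤ)) N, ∑ i ∈ Finset.range n, chi A (x + s + i)
        ≤ ∑ x ∈ Finset.Icc (-(N : ℤ)) N, (q + (p (x + s) - p x)) :=
      Finset.sum_le_sum fun x _ => h x
    rw [Finset.sum_add_distrib, Finset.sum_sub_distrib, Finset.sum_const, Int.card_Icc,
      nsmul_eq_mul, show ((N : ℤ) + 1 - -N).toNat = 2 * N + 1 by omega] at a₄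
    push_cast at a₄
    simp only [add_right_comm _ (s : ℤ)] at a₂ a₄
    have a₅ := mul_le_mul_of_nonneg_left a₃.1 (Int.natCast_nonneg n)
    rw [add_right_comm] at *
    nlinarith [a₁.2, a₂.1]
  have hn' : (0 : ℝ) < n := by exact_mod_cast hn
  have lim := tendsto_add_div_two_mul_add_one ((q : ℝ) / n)
    (((C * s + n * s + n * n : ℤ) : ℝ) / n)
  rw [upperDensity, ← lim.limsup_eq]
  refine limsup_le_limsup (Eventually.of_forall fun N => ?_)
    (isCoboundedUnder_le_of_le atTop (density_nonneg A)) lim.isBoundedUnder_le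
  have hb : (n : ℝ) * ((A ∩ Set.Icc (-(N : ℤ)) N).ncard : ℝ)
      ≤ q * (2 * N + 1) + ((C * s + n * s + n * n : ℤ) : ℝ) := by exact_mod_cast bound N
  have hN : (0 : ℝ) < 2 * N + 1 := by positivity
  rw [div_le_iff₀ hN, add_mul, div_mul_cancel₀ _ hN.ne', div_mul_eq_mul_div, ← add_div,
    le_div_iff₀ hn']
  linarith

lemma le_upperDensity_of_window {A : Set ℤ} {n : ℕ} {q : ℤ} (hn : 0 < n)
    (h : ∀ x, q ≤ ∑ i ∈ Finset.range n, chi A (x + i)) : (q : ℝ) / n ≤ upperDensity A := by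
  have bound (N : ℕ) : q * (2 * N + 1) - n * n
      ≤ (n : ℤ) * ((A ∩ Set.Icc (-(N : ℤ)) N).ncard : ℤ) := by
    rw [ncard_inter_Icc_eq]
    have a₂ := abs_le.1 (abs_sum_window_sub_le (chi_nonneg A) (chi_le_one A) n N)
    have a₄ : ∑ x ∈ Finset.Icc (-(N : ℤ)) N, q
        ≤ ∑ x ∈ Finset.Icc (-(N : ℤ)) N, ∑ i ∈ Finset.range n, chi A (x + i) :=
      Finset.sum_le_sum fun x _ => h x
    rw [Finset.sum_const, Int.card_Icc, nsmul_eq_mul,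
      show ((N : ℤ) + 1 - -N).toNat = 2 * N + 1 by omega] at a₄
    push_cast at a₄
    linarith [a₂.2]
  have hn' : (0 : ℝ) < n := by exact_mod_cast hn
  have lim := tendsto_add_div_two_mul_add_one ((q : ℝ) / n) (-((n * n : ℤ) : ℝ) / n)
  rw [upperDensity, ← lim.limsup_eq]
  refine limsup_le_limsup (Eventually.of_forall fun N => ?_) lim.isCoboundedUnder_le
    (isBoundedUnder_of ⟨1, fun N => ?_⟩)
  · have hb : (q * (2 * N + 1) : ℝ) - ((n * n : ℤ) : ℝ)
        ≤ (n : ℝ) * ((A ∩ Set.Icc (-(N : ℤ)) N).ncard : ℝ) := by exact_mod_cast bound N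
    have hN : (0 : ℝ) < 2 * N + 1 := by positivity
    rw [le_div_iff₀ hN, add_mul, div_mul_cancel₀ _ hN.ne', div_mul_eq_mul_div, ← add_div,
      div_le_iff₀ hn']
    linarith
  · have hN : (0 : ℝ) < 2 * N + 1 := by positivity
    rw [div_le_one hN]
    have : ((A ∩ Set.Icc (-(N : ℤ)) N).ncard : ℤ) ≤ 2 * N + 1 := by
      rw [ncard_inter_Icc_eq]
      refine (Finset.sum_le_sum fun x _ => chi_le_one A x).trans ?_
      rw [Finset.sum_const, Int.card_Icc, nsmul_eq_mul]
      omega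
    exact_mod_cast this

/-! ### Upper bounds -/

lemma chi_add_chi_le_one {S : Set ℕ} {A : Set ℤ} (hA : (distanceGraph S).IsIndepSet A) {d : ℕ}
    (hd : d ∈ S) (hd0 : d ≠ 0) (x : ℤ) : chi A x + chi A (x + d) ≤ 1 := by
  by_cases hx : x ∈ A
  · have hy : x + d ∉ A := fun hy =>
      hA hx hy (by omega) ⟨by omega, by
        rwa [show (x - (x + d)).natAbs = d by omega]⟩
    rw [chi_of_notMem hy]
    linarith [chi_le_one A x]
  · rw [chi_of_notMem hx]
    linarith [chi_le_one A (x + d)]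

section Upper

variable {k : ℕ} {A : Set ℤ}

lemma upperDensity_le_of_mod_ne (hk : 3 ≤ k) (hA : (distanceGraph {1, k, k + 3}).IsIndepSet A)
    (hmod : k % 5 ≠ 3) : upperDensity A ≤ (((2 * k + 8) / 5 : ℕ) : ℤ) / ((k + 4 : ℕ) : ℝ) := by
  set q : ℤ := (((2 * k + 8) / 5 : ℕ) : ℤ) with hq
  set f : ℤ → ℤ := fun x => ∑ i ∈ Finset.range (k + 4), chi A (x + i) with hf
  have hwin (x : ℤ) : 4 * f x + f (x + k) ≤ 2 * ((k : ℤ) + 4) := by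
    have := four_mul_window_add_window_le (k := k) (b := fun i => chi A (x + i))
      (fun i => by
        simpa [add_assoc] using chi_add_chi_le_one hA (d := 1) (by simp) (by simp) (x + i))
      (fun i => by
        simpa [add_assoc] using chi_add_chi_le_one hA (d := k) (by simp) (by omega) (x + i))
      (fun i => by
        simpa [add_assoc] using chi_add_chi_le_one hA (d := k + 3) (by simp) (by simp) (x + i))
    have e : ∀ i : ℕ, x + ((i + k : ℕ) : ℤ) = x + k + i := fun i => by push_cast; ring
    simpa only [hf, e] using this
  have hfC (x : ℤ) : f x ≤ k + 4 := by
    refine (Finset.sum_le_sum fun i _ => chi_le_one A _).trans ?_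
    simp
  refine upperDensity_le_of_window (s := k) (C := k + 4) (p := fun x => max (f x - q) 0)
    (by omega) (fun x => le_max_right _ _) (fun x => ?_) (fun x => ?_)
  · have := hfC x
    simp only [max_le_iff]
    omega
  · -- An excess `u ≥ 1` of the window at `x` forces a deficit of at least `4 * u - 3 ≥ u` at
    -- `x + k`, because `2 * (k + 4) ≤ 5 * q + 3`.
    have h := hwin x
    have hq3 : 2 * ((k : ℤ) + 4) ≤ 5 * q + 3 := by
      have : k % 5 = 0 ∨ k % 5 = 1 ∨ k % 5 = 2 ∨ k % 5 = 4 := by omega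
      rcases this with h | h | h | h <;> omega
    clear_value q
    change f (x + k) ≤ q + (max (f (x + k) - q) 0 - max (f x - q) 0)
    omega

lemma upperDensity_le_of_mod_eq (hk : 3 ≤ k) (hA : (distanceGraph {1, k, k + 3}).IsIndepSet A)
    (hmod : k % 5 = 3) : upperDensity A ≤ (((4 * k + 3) / 5 : ℕ) : ℤ) / ((2 * k + 3 : ℕ) : ℝ) := by
  refine upperDensity_le_of_window (s := 0) (C := 0) (p := 0) (by omega) (by simp) (by simp)
    (fun x => ?_)
  have := window_le (k := k) (r := k / 5) (b := fun i => chi A (x + i))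
    (fun i => chi_eq_zero_or_one A _)
    (fun i => by
      simpa [add_assoc] using chi_add_chi_le_one hA (d := 1) (by simp) (by simp) (x + i))
    (fun i => by
      simpa [add_assoc] using chi_add_chi_le_one hA (d := k) (by simp) (by omega) (x + i))
    (fun i => by
      simpa [add_assoc] using chi_add_chi_le_one hA (d := k + 3) (by simp) (by simp) (x + i))
    (by omega)
  simp only [Nat.cast_zero, add_zero, Pi.zero_apply, sub_zero]
  omega

end Upper

/-! ### Periodic independent sets -/

lemma isIndepSet_of_forall {S : Set ℕ} {A : Set ℤ} (h : ∀ d ∈ S, ∀ x ∈ A, x + (d : ℤ) ∉ A) :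
    (distanceGraph S).IsIndepSet A := by
  rintro x hx y hy hne ⟨-, hd⟩
  rcases le_total x y with hxy | hxy
  · refine h _ hd x hx ?_
    rwa [show x + ((x - y).natAbs : ℤ) = y by omega]
  · refine h _ hd y hy ?_
    rwa [show y + ((x - y).natAbs : ℤ) = x by omega]

lemma le_upperDensity_of_periodic {A : Set ℤ} {n : ℕ} {q : ℤ} (hn : 0 < n)
    (hA : ∀ x, x + (n : ℤ) ∈ A ↔ x ∈ A) (hq : q ≤ ∑ i ∈ Finset.range n, chi A i) :
    (q : ℝ) / n ≤ upperDensity A := by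
  have hchi (x : ℤ) : chi A (x + n) = chi A x := by
    by_cases hx : x ∈ A
    · rw [chi_of_mem hx, chi_of_mem ((hA x).2 hx)]
    · rw [chi_of_notMem hx, chi_of_notMem (mt (hA x).1 hx)]
  have hper : Function.Periodic (fun x : ℤ => ∑ i ∈ Finset.range n, chi A (x + i)) 1 := by
    intro x
    have := sum_range_shift (fun i => chi A (x + i)) n
    have e : ∀ i : ℕ, x + ((i + 1 : ℕ) : ℤ) = x + 1 + i := fun i => by push_cast; ring
    simp only [e, hchi, Nat.cast_zero, add_zero] at this
    change ∑ i ∈ Finset.range n, chi A (x + 1 + i) = _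
    rw [this]
    ring
  refine le_upperDensity_of_window hn fun x => hq.trans (le_of_eq ?_)
  have := hper.int_mul_eq x
  simp only [Int.cast_id, mul_one, zero_add] at this
  exact this.symm

lemma emod_add_cases {n d : ℤ} (x : ℤ) (hd : 0 ≤ d) (hdn : d < n) :
    ((x + d) % n = x % n + d ∧ x % n + d < n) ∨
      ((x + d) % n = x % n + d - n ∧ n ≤ x % n + d) := by
  have h₀ := Int.emod_nonneg x (by omega : n ≠ 0)
  have h₁ := Int.emod_lt_of_pos x (by omega : 0 < n)
  have e : (x + d) % n = (x % n + d) % n := by simp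
  rcases lt_or_ge (x % n + d) n with h | h
  · exact Or.inl ⟨by rw [e, Int.emod_eq_of_lt (by omega) h], h⟩
  · refine Or.inr ⟨?_, h⟩
    rw [e, ← Int.sub_emod_right, Int.emod_eq_of_lt (by omega) (by omega)]

/-- The periodic set of period `5 * M + 3 * t` whose successive gaps are `M` times `2, 3` followed
by `t` times `3`. -/
def gapSet (M t : ℕ) : Set ℤ :=
  {x | (x % (5 * M + 3 * t) < 5 * M ∧
      (x % (5 * M + 3 * t) % 5 = 0 ∨ x % (5 * M + 3 * t) % 5 = 2)) ∨
    (5 * M ≤ x % (5 * M + 3 * t) ∧ (x % (5 * M + 3 * t) - 5 * M) % 3 = 0)}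

lemma add_natCast_mem_gapSet (M t : ℕ) (x : ℤ) :
    x + ((5 * M + 3 * t : ℕ) : ℤ) ∈ gapSet M t ↔ x ∈ gapSet M t := by
  simp [gapSet]

lemma le_upperDensity_gapSet {M t : ℕ} (h : 0 < 5 * M + 3 * t) :
    (((2 * M + t : ℕ) : ℤ) : ℝ) / ((5 * M + 3 * t : ℕ) : ℝ) ≤ upperDensity (gapSet M t) := by
  refine le_upperDensity_of_periodic h (add_natCast_mem_gapSet M t) ?_
  have mem {i : ℕ} (hi : i < 5 * M + 3 * t)
      (h' : (i < 5 * M ∧ (i % 5 = 0 ∨ i % 5 = 2)) ∨ (5 * M ≤ i ∧ (i - 5 * M) % 3 = 0)) :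
      chi (gapSet M t) i = 1 := by
    refine chi_of_mem ?_
    have e : (i : ℤ) % (5 * M + 3 * t) = i := Int.emod_eq_of_lt (by omega) (by omega)
    simp only [gapSet, Set.mem_ofPred_eq, e]
    omega
  have nn := chi_nonneg (gapSet M t)
  have three : ∀ u ≤ t,
      (u : ℤ) ≤ ∑ i ∈ Finset.range (3 * u), chi (gapSet M t) ((5 * M + i : ℕ)) := by
    intro u hu
    induction u with
    | zero => simp
    | succ u ih =>
      have := ih (by omega)
      have m := mem (i := 5 * M + 3 * u) (by omega) (by omega)
      rw [show 3 * (u + 1) = 3 * u + 3 by ring]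
      simp only [Finset.sum_range_succ]
      rw [m]
      have n₁ := nn ((5 * M + (3 * u + 1) : ℕ))
      have n₂ := nn ((5 * M + (3 * u + 2) : ℕ))
      push_cast at *
      linarith
  have five : (2 * M : ℤ) ≤ ∑ i ∈ Finset.range (5 * M), chi (gapSet M t) (i : ℕ) := by
    rw [sum_range_five_mul (fun i => chi (gapSet M t) (i : ℕ))]
    calc (2 * M : ℤ) = ∑ i ∈ Finset.range M, (2 : ℤ) := by simp [mul_comm]
      _ ≤ _ := Finset.sum_le_sum fun i hi => by
        have hi := Finset.mem_range.1 hi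
        rw [mem (i := 5 * i) (by omega) (by omega), mem (i := 5 * i + 2) (by omega) (by omega)]
        have n₁ := nn ((5 * i + 1 : ℕ))
        have n₂ := nn ((5 * i + 3 : ℕ))
        have n₃ := nn ((5 * i + 4 : ℕ))
        linarith
  rw [Finset.sum_range_add (fun i : ℕ => chi (gapSet M t) (i : ℤ))]
  have := three t le_rfl
  push_cast at *
  linarith

/-- The gaps of `gapSet M t` are `2` or `3` and no two consecutive ones sum to `4`, so the
differences `1` and `4` do not occur; modulo the period `k + 4` these are `-(k + 3)` and `-k`. -/
lemma isIndepSet_gapSet {M t k : ℕ} (hk : k + 4 = 5 * M + 3 * t) (hk3 : 3 ≤ k) :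
    (distanceGraph {1, k, k + 3}).IsIndepSet (gapSet M t) := by
  have pos : 4 < (5 * M + 3 * t : ℤ) := by omega
  have main (d : ℤ) (hd : d = 1 ∨ d = 4) (x : ℤ) (hx : x ∈ gapSet M t) :
      x + d ∉ gapSet M t := by
    have hc := emod_add_cases (n := 5 * M + 3 * t) (d := d) x (by omega) (by omega)
    have h₀ := Int.emod_nonneg x (by omega : (5 * M + 3 * t : ℤ) ≠ 0)
    have hlt := Int.emod_lt_of_pos x (by omega : (0 : ℤ) < 5 * M + 3 * t)
    intro hy
    simp only [gapSet, Set.mem_ofPred_eq] at hx hy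
    generalize (x + d) % (5 * M + 3 * t : ℤ) = v at *
    generalize x % (5 * M + 3 * t : ℤ) = u at *
    -- In the last part of a period, only its last element is within distance `4` of the end.
    have last (h₁ : (u - 5 * M) % 3 = 0) (h₂ : 5 * M + 3 * t ≤ u + d) (h₃ : u < 5 * M + 3 * t) :
        u = 5 * M + 3 * t - 3 := by
      obtain ⟨j, hj⟩ := Int.dvd_of_emod_eq_zero h₁
      omega
    rcases hc with ⟨rfl, _⟩ | ⟨rfl, hwrap⟩
    · rcases hd with rfl | rfl <;> omega
    · rcases hx with hx | ⟨_, hmod⟩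
      · rcases hd with rfl | rfl <;> omega
      · have := last hmod hwrap hlt
        rcases hd with rfl | rfl <;> omega
  refine isIndepSet_of_forall ?_
  rintro d (rfl | rfl | rfl) x hx hy
  · exact main 1 (Or.inl rfl) x hx hy
  · refine main 4 (Or.inr rfl) _ hy ?_
    rw [show x + (d : ℤ) + 4 = x + ((5 * M + 3 * t : ℕ) : ℤ) by omega]
    exact (add_natCast_mem_gapSet M t x).2 hx
  · refine main 1 (Or.inl rfl) _ hy ?_
    rw [show x + ((k + 3 : ℕ) : ℤ) + 1 = x + ((5 * M + 3 * t : ℕ) : ℤ) by omega]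
    exact (add_natCast_mem_gapSet M t x).2 hx

/-- The periodic set of period `10 * r + 9` consisting of the `x` for which `2 * x` is congruent to
one of `0, 1, 5, 6, …, 10 * r, 10 * r + 1, 10 * r + 5`. -/
def doubledGapSet (r : ℕ) : Set ℤ :=
  {x | (2 * x % (10 * r + 9) % 5 = 0 ∨ 2 * x % (10 * r + 9) % 5 = 1) ∧
    2 * x % (10 * r + 9) ≤ 10 * r + 5}

lemma add_natCast_mem_doubledGapSet (r : ℕ) (x : ℤ) :
    x + ((10 * r + 9 : ℕ) : ℤ) ∈ doubledGapSet r ↔ x ∈ doubledGapSet r := by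
  have : 2 * (x + ((10 * r + 9 : ℕ) : ℤ)) % (10 * r + 9) = 2 * x % (10 * r + 9) := by
    rw [show 2 * (x + ((10 * r + 9 : ℕ) : ℤ)) = 2 * x + (10 * r + 9 : ℤ) * 2 by push_cast; ring,
      Int.add_mul_emod_self_left]
  simp only [doubledGapSet, Set.mem_ofPred_eq, this]

lemma le_upperDensity_doubledGapSet (r : ℕ) :
    (((4 * r + 3 : ℕ) : ℤ) : ℝ) / ((10 * r + 9 : ℕ) : ℝ) ≤ upperDensity (doubledGapSet r) := by
  refine le_upperDensity_of_periodic (by omega) (add_natCast_mem_doubledGapSet r) ?_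
  have lo {i : ℕ} (hi : i ≤ 5 * r + 2) (h' : i % 5 = 0 ∨ i % 5 = 3) :
      chi (doubledGapSet r) i = 1 := by
    refine chi_of_mem ?_
    have e : 2 * (i : ℤ) % (10 * r + 9) = 2 * i := Int.emod_eq_of_lt (by omega) (by omega)
    simp only [doubledGapSet, Set.mem_ofPred_eq, e]
    omega
  have hi {i : ℕ} (hi : i ≤ 5 * r + 2) (h' : i % 5 = 0 ∨ i % 5 = 2) :
      chi (doubledGapSet r) ((5 * r + 5 + i : ℕ)) = 1 := by
    refine chi_of_mem ?_
    have e : 2 * ((5 * r + 5 + i : ℕ) : ℤ) % (10 * r + 9) = 2 * i + 1 := by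
      rw [show 2 * ((5 * r + 5 + i : ℕ) : ℤ) = 2 * i + 1 + (10 * r + 9) by push_cast; ring,
        Int.add_emod_right, Int.emod_eq_of_lt (by omega) (by omega)]
    simp only [doubledGapSet, Set.mem_ofPred_eq, e]
    omega
  have nn := chi_nonneg (doubledGapSet r)
  have low : (2 * r : ℤ) ≤ ∑ i ∈ Finset.range (5 * r), chi (doubledGapSet r) (i : ℕ) := by
    rw [sum_range_five_mul (fun i => chi (doubledGapSet r) (i : ℕ))]
    calc (2 * r : ℤ) = ∑ i ∈ Finset.range r, (2 : ℤ) := by simp [mul_comm]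
      _ ≤ _ := Finset.sum_le_sum fun i hi => by
        have hi := Finset.mem_range.1 hi
        rw [lo (i := 5 * i) (by omega) (by omega), lo (i := 5 * i + 3) (by omega) (by omega)]
        have n₁ := nn ((5 * i + 1 : ℕ))
        have n₂ := nn ((5 * i + 2 : ℕ))
        have n₃ := nn ((5 * i + 4 : ℕ))
        linarith
  have high : (2 * r : ℤ)
      ≤ ∑ i ∈ Finset.range (5 * r), chi (doubledGapSet r) ((5 * r + 5 + i : ℕ)) := by
    rw [sum_range_five_mul (fun i => chi (doubledGapSet r) ((5 * r + 5 + i : ℕ)))]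
    calc (2 * r : ℤ) = ∑ i ∈ Finset.range r, (2 : ℤ) := by simp [mul_comm]
      _ ≤ _ := Finset.sum_le_sum fun i hir => by
        have hir := Finset.mem_range.1 hir
        rw [hi (i := 5 * i) (by omega) (by omega), hi (i := 5 * i + 2) (by omega) (by omega)]
        have n₁ := nn ((5 * r + 5 + (5 * i + 1) : ℕ))
        have n₂ := nn ((5 * r + 5 + (5 * i + 3) : ℕ))
        have n₃ := nn ((5 * r + 5 + (5 * i + 4) : ℕ))
        linarith
  have tail₁ : (2 * r + 1 : ℤ)
      ≤ ∑ i ∈ Finset.range (5 * r + 5), chi (doubledGapSet r) (i : ℕ) := by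
    calc (2 * r + 1 : ℤ) ≤ ∑ i ∈ Finset.range (5 * r + 1), chi (doubledGapSet r) (i : ℕ) := by
          rw [Finset.sum_range_succ, lo (i := 5 * r) (by omega) (by omega)]
          linarith
      _ ≤ _ := Finset.sum_le_sum_of_subset_of_nonneg
          (Finset.range_subset_range.2 (by omega)) fun i _ _ => nn _
  have tail₂ : (2 * r + 2 : ℤ)
      ≤ ∑ i ∈ Finset.range (5 * r + 4), chi (doubledGapSet r) ((5 * r + 5 + i : ℕ)) := by
    simp only [Finset.sum_range_succ]
    rw [hi (i := 5 * r) (by omega) (by omega), hi (i := 5 * r + 2) (by omega) (by omega)]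
    have n₁ := nn ((5 * r + 5 + (5 * r + 1) : ℕ))
    have n₂ := nn ((5 * r + 5 + (5 * r + 3) : ℕ))
    linarith
  rw [show 10 * r + 9 = 5 * r + 5 + (5 * r + 4) by ring,
    Finset.sum_range_add (fun i : ℕ => chi (doubledGapSet r) (i : ℤ))]
  push_cast at *
  linarith

/-- After doubling, the steps `1` and `k + 3` become `2` and `3`, and `k` becomes `-3`. The residues
defining `doubledGapSet r` have no difference `2` or `3`, and being at most `10 * r + 5` they admit
no such difference across the period either. -/
lemma isIndepSet_doubledGapSet {r k : ℕ} (hk : k = 5 * r + 3) :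
    (distanceGraph {1, k, k + 3}).IsIndepSet (doubledGapSet r) := by
  have main (d : ℤ) (hd : d = 2 ∨ d = 3) (x y : ℤ) (hx : x ∈ doubledGapSet r)
      (hxy : 2 * y % (10 * r + 9) = (2 * x + d) % (10 * r + 9)) : y ∉ doubledGapSet r := by
    have hc := emod_add_cases (n := 10 * r + 9) (d := d) (2 * x) (by omega) (by omega)
    have h₀ := Int.emod_nonneg (2 * x) (by omega : (10 * r + 9 : ℤ) ≠ 0)
    simp only [doubledGapSet, Set.mem_ofPred_eq, hxy] at hx ⊢
    generalize (2 * x + d) % (10 * r + 9 : ℤ) = v at *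
    generalize 2 * x % (10 * r + 9 : ℤ) = u at *
    rcases hd with rfl | rfl <;> omega
  refine isIndepSet_of_forall ?_
  rintro d (rfl | rfl | rfl) x hx hy
  · exact main 2 (Or.inl rfl) x _ hx (by congr 1; push_cast; ring) hy
  · refine main 3 (Or.inr rfl) _ x hy ?_ hx
    rw [show 2 * (x + (d : ℤ)) + 3 = 2 * x + (10 * r + 9) by rw [hk]; push_cast; ring,
      Int.add_emod_right]
  · refine main 3 (Or.inr rfl) x _ hx ?_ hy
    rw [show 2 * (x + ((k + 3 : ℕ) : ℤ)) = 2 * x + 3 + (10 * r + 9) by rw [hk]; push_cast; ring,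
      Int.add_emod_right]

/-! ### The independence ratio -/

lemma independenceRatio_eq_of_mod_ne {k : ℕ} (hk : 3 ≤ k) (hmod : k % 5 ≠ 3) :
    independenceRatio {1, k, k + 3} = (((2 * k + 8) / 5 : ℕ) : ℤ) / ((k + 4 : ℕ) : ℝ) := by
  -- The number `t` of extra gaps `3` is the residue of `2 * (k + 4)` modulo `5`.
  obtain ⟨M, t, ht, hMt⟩ : ∃ M t : ℕ, t ≤ 3 ∧ k + 4 = 5 * M + 3 * t :=
    ⟨(k + 4 - 3 * (2 * (k + 4) % 5)) / 5, 2 * (k + 4) % 5, by omega, by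
      have : k % 5 = 0 ∨ k % 5 = 1 ∨ k % 5 = 2 ∨ k % 5 = 4 := by omega
      rcases this with h | h | h | h <;> omega⟩
  have hind := isIndepSet_gapSet hMt hk
  refine IsGreatest.csSup_eq ⟨⟨gapSet M t, hind,
    le_antisymm (upperDensity_le_of_mod_ne hk hind hmod) ?_⟩, ?_⟩
  · have := le_upperDensity_gapSet (M := M) (t := t) (by omega)
    rwa [hMt, show (2 * k + 8) / 5 = 2 * M + t by omega]
  · rintro _ ⟨A, hA, rfl⟩
    exact upperDensity_le_of_mod_ne hk hA hmod

lemma independenceRatio_eq_of_mod_eq {k : ℕ} (hk : 3 ≤ k) (hmod : k % 5 = 3) :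
    independenceRatio {1, k, k + 3} = (((4 * k + 3) / 5 : ℕ) : ℤ) / ((2 * k + 3 : ℕ) : ℝ) := by
  obtain ⟨r, hr⟩ : ∃ r : ℕ, k = 5 * r + 3 := ⟨k / 5, by omega⟩
  have hind := isIndepSet_doubledGapSet hr
  refine IsGreatest.csSup_eq ⟨⟨doubledGapSet r, hind,
    le_antisymm (upperDensity_le_of_mod_eq hk hind hmod) ?_⟩, ?_⟩
  · have := le_upperDensity_doubledGapSet r
    rwa [show (4 * k + 3) / 5 = 4 * r + 3 by omega, show 2 * k + 3 = 10 * r + 9 by omega]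
  · rintro _ ⟨A, hA, rfl⟩
    exact upperDensity_le_of_mod_eq hk hA hmod

theorem mainTheorem3 (k : ℕ) (hk : 3 ≤ k) :
    (k % 5 = 0 →
      independenceRatio {1, k, k + 3} = (2 * (k : ℝ) + 5) / (5 * (k : ℝ) + 20)) ∧
    (k % 5 = 1 →
      independenceRatio {1, k, k + 3} = 2 / 5) ∧
    (k % 5 = 2 →
      independenceRatio {1, k, k + 3} = (2 * (k : ℝ) + 6) / (5 * (k : ℝ) + 20)) ∧
    (k % 5 = 3 →
      independenceRatio {1, k, k + 3} = (4 * (k : ℝ) + 3) / (10 * (k : ℝ) + 15)) ∧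
    (k % 5 = 4 →
      independenceRatio {1, k, k + 3} = (2 * (k : ℝ) + 7) / (5 * (k : ℝ) + 20)) := by
  have hpos : (0 : ℝ) < k + 4 := by positivity
  have value (c : ℕ) (hc : (2 * k + c) % 5 = 0) (hc4 : 4 ≤ c) (hc8 : c ≤ 8) (hmod : k % 5 ≠ 3) :
      independenceRatio {1, k, k + 3} = (2 * (k : ℝ) + c) / (5 * (k : ℝ) + 20) := by
    have hq : 5 * ((2 * k + 8) / 5) = 2 * k + c := by omega
    have hq' : 5 * (((2 * k + 8) / 5 : ℕ) : ℝ) = 2 * k + c := by exact_mod_cast hq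
    rw [independenceRatio_eq_of_mod_ne hk hmod, ← hq']
    generalize (2 * k + 8) / 5 = w
    push_cast
    field_simp
    ring
  refine ⟨fun h => ?_, fun h => ?_, fun h => ?_, fun h => ?_, fun h => ?_⟩
  · exact_mod_cast value 5 (by omega) (by omega) (by omega) (by omega)
  · rw [value 8 (by omega) (by omega) (by omega) (by omega)]
    push_cast
    field_simp
    ring
  · exact_mod_cast value 6 (by omega) (by omega) (by omega) (by omega)
  · have hq : 5 * ((4 * k + 3) / 5) = 4 * k + 3 := by omega
    have hq' : 5 * (((4 * k + 3) / 5 : ℕ) : ℝ) = 4 * k + 3 := by exact_mod_cast hq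
    rw [independenceRatio_eq_of_mod_eq hk h, ← hq']
    generalize (4 * k + 3) / 5 = w
    push_cast
    field_simp
    ring
  · exact_mod_cast value 7 (by omega) (by omega) (by omega) (by omega)
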